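/- Let $\mathbf K$ be a field that is complete with respect to a nontrivial multiplicative real-valued non-Archimedean norm $|\cdot|$ (nontrivial: $|x|>1$ for some $x\in\mathbf K$). Let $X$ be either the Banach space $c_0=c_0(\mathbb N,\mathbf K)$ of all sequences in $\mathbf K$ converging to $0$, with the norm $\|x\|=\sup_j|x_j|$ and the norm topology, or the space $\mathbf s=\mathbf K^{\mathbb N}$ of all sequences in $\mathbf K$ with the product topology; let $\pi_j:X\to\mathbf K$, $\pi_j(x)=x_j$, be the coordinate projections. A set $E\subset X$ is called infinitely deficient if there is an infinite set $\beta\subset\mathbb N$ such that $\pi_j(E)$ consists of exactly one element for every $j\in\beta$. Let $U\subset X$ be open and let $(K_j)_{j\in\mathbb N}$ be a sequence of closed subsets of $X$ such that $K_j\subset U$ and $K_j$ is infinitely deficient for each $j$. Then there is a homeomorphism $g$ of $X\setminus\bigcup_{j}K_j$ (with the subspace topology) onto $X$ such that $g(x)=x$ for every $x\in X\setminus U$. -/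

import Mathlib

open scoped ZeroAtInfty

/-- `E` is deficient in the `j`-th direction: its projection to the `j`-th coordinate is a
singleton. Here `coord x j` is the `j`-th coordinate of the point `x`. -/
def DeficientInDirection {X K : Type*} (coord : X → ℕ → K) (E : Set X) (j : ℕ) : Prop :=
  ∃ c : K, (fun x : X => coord x j) '' E = {c}

/-- `E` is infinitely deficient: it is deficient in all directions of some infinite set. -/
def InfinitelyDeficient {X K : Type*} (coord : X → ℕ → K) (E : Set X) : Prop :=
  ∃ β : Set ℕ, β.Infinite ∧ ∀ j ∈ β, DeficientInDirection coord E j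

/-! ### Ultrametric-like spaces with uniformly branching bases -/

open Set Filter Topology

/-! The topology of X is generated by a complete decreasing sequence of partitions into clopen
classes. Each level has at most #I classes and each class contains #I points separated at some finer
level, so every nonempty open set is a disjoint union of exactly #I arbitrarily fine classes
(`exists_partition`). Splitting repeatedly, and removing one closed nowhere dense set before each
splitting, shows that a nonempty open B minus countably many such sets is homeomorphic to I^ℕ
(`exists_homeomorph_pi`). With nothing removed, B itself is I^ℕ too, so B minus the sets is
homeomorphic to B. Apply this in each maximal class contained in U and use the identity off U. The
classes shrink towards the boundary of U, so the glued map is continuous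
(`exists_homeomorph_compl`). A deficient set has a constant coordinate, hence empty interior. For
both spaces I = ℕ × Q, with Q the residues of the unit ball modulo some a with 0 < |a| < 1. -/

/-- A decreasing sequence of equivalence relations whose classes form a complete basis of the
topology, such that every class splits into exactly `#I` classes of some finer relation. -/
structure IsBranchingBasis {X : Type*} [TopologicalSpace X] (R : ℕ → Setoid X) (I : Type*) :
    Prop where
  anti : ∀ n, R (n + 1) ≤ R n
  basis : ∀ x, (𝓝 x).HasBasis (fun _ : ℕ => True) (fun n => {y | R n x y})
  sep : ∀ x y, (∀ n, R n x y) → x = y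
  complete : ∀ u : ℕ → X, (∀ n, R n (u n) (u (n + 1))) → ∃ x, ∀ n, R n x (u n)
  embed : ∀ n, Nonempty (Quotient (R n) ↪ I)
  branch : ∀ x n, ∃ m, ∃ f : I → X, (∀ i, R n x (f i)) ∧ ∀ i j, R m (f i) (f j) → i = j
  index : Nonempty (ℕ × I ↪ I)

namespace IsBranchingBasis

variable {X : Type*} [TopologicalSpace X] {R : ℕ → Setoid X} {I : Type*}

theorem antitone (hR : IsBranchingBasis R I) : Antitone R := antitone_nat_of_succ_le hR.anti

theorem mono (hR : IsBranchingBasis R I) {m n : ℕ} (h : m ≤ n) {x y : X} (hxy : R n x y) :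
    R m x y := hR.antitone h hxy

theorem isOpen_class (hR : IsBranchingBasis R I) (n : ℕ) (x : X) : IsOpen {y | R n x y} := by
  rw [isOpen_iff_mem_nhds]
  intro y hy
  refine (hR.basis y).mem_iff.2 ⟨n, trivial, fun z hz => ?_⟩
  exact (R n).trans hy hz

theorem exists_class_subset (hR : IsBranchingBasis R I) {W : Set X} (hW : IsOpen W) {x : X}
    (hx : x ∈ W) : ∃ n, {y | R n x y} ⊆ W := by
  obtain ⟨n, -, h⟩ := (hR.basis x).mem_iff.1 (hW.mem_nhds hx)
  exact ⟨n, h⟩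

/-- An open set is partitioned into its maximal classes of level at least `N`. -/
theorem exists_level (hR : IsBranchingBasis R I) {W : Set X} (hW : IsOpen W) (N : ℕ) :
    ∃ k : X → ℕ, (∀ x, N ≤ k x) ∧ (∀ x ∈ W, {y | R (k x) x y} ⊆ W) ∧
      ∀ x ∈ W, ∀ y, R (k x) x y → k y = k x := by
  classical
  have hex : ∀ x, ∃ n, N ≤ n ∧ (x ∈ W → {y | R n x y} ⊆ W) := by
    intro x
    by_cases hx : x ∈ W
    · obtain ⟨n, hn⟩ := hR.exists_class_subset hW hx
      exact ⟨max N n, le_max_left _ _,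
        fun _ y hy => hn (hR.mono (le_max_right _ _) hy)⟩
    · exact ⟨N, le_rfl, fun h => absurd h hx⟩
  refine ⟨fun x => Nat.find (hex x), fun x => (Nat.find_spec (hex x)).1,
    fun x hx => (Nat.find_spec (hex x)).2 hx, fun x hx y hxy => ?_⟩
  have hx' := (Nat.find_spec (hex x)).2 hx
  have hle : Nat.find (hex y) ≤ Nat.find (hex x) :=
    Nat.find_min' _ ⟨(Nat.find_spec (hex x)).1, fun _ z hz => hx' ((R _).trans hxy hz)⟩
  refine le_antisymm hle (Nat.find_min' _ ⟨(Nat.find_spec (hex y)).1, fun _ z hz => ?_⟩)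
  exact (Nat.find_spec (hex y)).2 (hx' hxy) ((R _).trans ((R _).symm (hR.mono hle hxy)) hz)

/-- The maximal classes in `W` of level at least `max n m₀` inject into `I`, being coded by level
and label. Conversely `I` injects into them by branching, so Schröder–Bernstein indexes them by `I`.
-/
theorem exists_partition (hR : IsBranchingBasis R I) {W : Set X} (hW : IsOpen W)
    (hne : W.Nonempty) (n : ℕ) :
    ∃ P : I → Set X, (∀ i, ∃ m ≥ n, ∃ c, P i = {y | R m c y}) ∧
      (∀ i j x, x ∈ P i → x ∈ P j → i = j) ∧ ⋃ i, P i = W := by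
  obtain ⟨x₀, hx₀⟩ := hne
  obtain ⟨n₀, hn₀⟩ := hR.exists_class_subset hW hx₀
  obtain ⟨m₀, f, hf, hinj⟩ := hR.branch x₀ n₀
  obtain ⟨k, hk, hkW, hkeq⟩ := hR.exists_level hW (max n m₀)
  let S : Setoid W :=
    { r := fun x y => R (k x) x y
      iseqv :=
        { refl := fun x => (R _).refl _
          symm := fun {x y} h => by
            rw [hkeq x x.2 y h]
            exact (R _).symm h
          trans := fun {x y z} h h' => by
            rw [hkeq x x.2 y h] at h'
            exact (R _).trans h h' } }
  obtain ⟨ι⟩ := hR.index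
  have label : ∀ n, ∃ q : X → I, ∀ x y, q x = q y ↔ R n x y := fun n => by
    obtain ⟨e⟩ := hR.embed n
    exact ⟨fun x => e (Quotient.mk _ x), fun x y => e.injective.eq_iff.trans Quotient.eq⟩
  choose q hq using label
  let F : Quotient S → I := Quotient.lift (fun x : W => ι (k x, q (k x) x)) (by
    intro x y h
    have h' : k y = k x := hkeq x x.2 y h
    have h2 : q (k x) x = q (k x) y := (hq _ _ _).2 h
    simp only [h', h2])
  have hF : Function.Injective F := by
    intro a b
    induction a using Quotient.inductionOn with | _ x => ?_
    induction b using Quotient.inductionOn with | _ y => ?_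
    intro h
    have h1 := ι.injective h
    rw [Prod.mk.injEq] at h1
    obtain ⟨h1, h2⟩ := h1
    rw [← h1] at h2
    exact Quotient.sound ((hq _ _ _).1 h2)
  -- The points `f i` are separated at level `m₀`, and all levels `k` are at least `m₀`, so they lie
  -- in distinct pieces.
  let G : I → Quotient S := fun i => Quotient.mk S ⟨f i, hn₀ (hf i)⟩
  have hG : Function.Injective G := by
    intro i j h
    have h1 : R (k (f i)) (f i) (f j) := Quotient.exact (s := S) h
    exact hinj i j (hR.mono ((le_max_right _ _).trans (hk _)) h1)
  obtain ⟨b, hb⟩ := Function.Embedding.schroeder_bernstein hG hF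
  let c : I → W := fun i => (b i).out
  refine ⟨fun i => {y | R (k (c i)) (c i) y},
    fun i => ⟨_, (le_max_left _ _).trans (hk _), _, rfl⟩, ?_, ?_⟩
  · intro i j x hi hj
    have hxi : k x = k (c i) := hkeq _ (c i).2 _ hi
    have hxj : k x = k (c j) := hkeq _ (c j).2 _ hj
    have : S (c i) (c j) := by
      refine (R (k (c i))).trans hi ((R _).symm ?_)
      rw [← hxi, hxj]
      exact hj
    apply hb.1
    rw [← Quotient.out_eq (b i), ← Quotient.out_eq (b j)]
    exact Quotient.sound this
  · ext x
    simp only [mem_iUnion, mem_ofPred_eq]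
    constructor
    · rintro ⟨i, hi⟩
      exact hkW _ (c i).2 hi
    · intro hx
      obtain ⟨i, hi⟩ := hb.2 (Quotient.mk S ⟨x, hx⟩)
      refine ⟨i, ?_⟩
      have : S (c i) ⟨x, hx⟩ := Quotient.exact (by rw [Quotient.out_eq, hi])
      exact this

/-- Complements of countably many closed nowhere dense sets in an open set are coded by sequences
of indices. -/
theorem exists_homeomorph_pi (hR : IsBranchingBasis R I) [TopologicalSpace I] [DiscreteTopology I]
    {B : Set X} (hB : IsOpen B) (hne : B.Nonempty) {F : ℕ → Set X} (hF : ∀ n, IsClosed (F n))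
    (hF' : ∀ n, interior (F n) = ∅) :
    Nonempty (↥(B \ ⋃ n, F n) ≃ₜ (ℕ → I)) := by
  classical
  have hP := fun (W : Set X) (hW : IsOpen W ∧ W.Nonempty) (n : ℕ) =>
    hR.exists_partition hW.1 hW.2 n
  choose! P hPc hPd hPu using hP
  -- `V n f` is the piece reached by following the first `n` indices of `f`; `F n` is removed before
  -- the splitting at stage `n`.
  let V : ℕ → (ℕ → I) → Set X := fun n f =>
    Nat.rec B (fun n W => P (W \ F n) n (f n)) n
  have V0 : ∀ f, V 0 f = B := fun _ => rfl
  have Vs : ∀ n f, V (n + 1) f = P (V n f \ F n) n (f n) := fun _ _ => rfl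
  have diff_ok : ∀ n (W : Set X), IsOpen W ∧ W.Nonempty →
      IsOpen (W \ F n) ∧ (W \ F n).Nonempty := by
    intro n W hW
    refine ⟨hW.1.sdiff (hF n), ?_⟩
    rw [nonempty_iff_ne_empty, Ne, sdiff_eq_empty]
    intro h
    have := interior_maximal h hW.1
    rw [hF' n] at this
    exact hW.2.ne_empty (subset_empty_iff.1 this)
  have V_ok : ∀ f n, IsOpen (V n f) ∧ (V n f).Nonempty := by
    intro f n
    induction n with
    | zero => exact ⟨hB, hne⟩
    | succ n ih =>
      obtain ⟨m, -, c, h⟩ := hPc _ (diff_ok n _ ih) n (f n)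
      rw [Vs, h]
      exact ⟨hR.isOpen_class _ _, c, (R m).refl c⟩
  have V_sub : ∀ f n, V (n + 1) f ⊆ V n f \ F n := by
    intro f n
    rw [← hPu _ (diff_ok n _ (V_ok f n)) n]
    exact subset_iUnion (P _ n) (f n)
  have V_anti : ∀ f, Antitone (fun n => V n f) := fun f =>
    antitone_nat_of_succ_le fun n => (V_sub f n).trans sdiff_subset
  have V_small : ∀ f n x y, x ∈ V (n + 1) f → y ∈ V (n + 1) f → R n x y := by
    intro f n x y hx hy
    obtain ⟨m, hm, c, h⟩ := hPc _ (diff_ok n _ (V_ok f n)) n (f n)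
    rw [Vs, h] at hx hy
    exact hR.mono hm ((R m).trans ((R m).symm hx) hy)
  have V_congr : ∀ f g n, (∀ k < n, f k = g k) → V n f = V n g := by
    intro f g n h
    induction n with
    | zero => rfl
    | succ n ih => rw [Vs, Vs, ih fun k hk => h k (by omega), h n (by omega)]
  have V_inj : ∀ f g n x, x ∈ V n f → x ∈ V n g → ∀ k < n, f k = g k := by
    intro f g n x hf hg
    induction n with
    | zero => intro k hk; omega
    | succ n ih =>
      have ih' := ih (V_anti f n.le_succ hf) (V_anti g n.le_succ hg)
      intro k hk
      rcases Nat.lt_succ_iff_lt_or_eq.1 hk with h | rfl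
      · exact ih' k h
      · rw [Vs] at hf hg
        rw [← V_congr f g k ih'] at hg
        exact hPd _ (diff_ok k _ (V_ok f k)) k _ _ x hf hg
  have code : ∀ x : ↥(B \ ⋃ n, F n), ∃ f, ∀ n, (x : X) ∈ V n f := by
    rintro ⟨x, hxB, hxF⟩
    have hxF' : ∀ n, x ∉ F n := fun n h => hxF (mem_iUnion.2 ⟨n, h⟩)
    have step : ∀ n (W : Set X), IsOpen W ∧ W.Nonempty → x ∈ W → ∃ i, x ∈ P (W \ F n) n i := by
      intro n W hW hx
      have : x ∈ ⋃ i, P (W \ F n) n i := by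
        rw [hPu _ (diff_ok n _ hW) n]
        exact ⟨hx, hxF' n⟩
      exact mem_iUnion.1 this
    obtain ⟨i₀, -⟩ := step 0 B ⟨hB, hne⟩ hxB
    have : Nonempty I := ⟨i₀⟩
    choose! i hi using step
    let W : ℕ → Set X := fun n => Nat.rec B (fun n W => P (W \ F n) n (i n W)) n
    have hW : ∀ n, V n (fun n => i n (W n)) = W n := by
      intro n
      induction n with
      | zero => rfl
      | succ n ih => rw [Vs, ih]
    refine ⟨fun n => i n (W n), fun n => ?_⟩
    induction n with
    | zero => exact hxB
    | succ n ih =>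
      have h := hi n _ (V_ok _ n) ih
      rw [hW] at h
      rw [Vs, hW]
      exact h
  have point : ∀ f, ∃ x : ↥(B \ ⋃ n, F n), ∀ n, (x : X) ∈ V n f := by
    intro f
    choose u hu using fun n => (V_ok f (n + 1)).2
    obtain ⟨x, hx⟩ := hR.complete u fun n =>
      V_small f n _ _ (hu n) (V_anti f (by omega : n + 1 ≤ n + 1 + 1) (hu (n + 1)))
    -- The piece is a single class of some level `m`; the limit shares that class with `u (max m
    -- n)`, so it stays in the piece.
    have hmem : ∀ n, x ∈ V (n + 1) f := by
      intro n
      obtain ⟨m, -, c, h⟩ := hPc _ (diff_ok n _ (V_ok f n)) n (f n)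
      have h1 : u (max m n) ∈ V (n + 1) f :=
        V_anti f (Nat.succ_le_succ (le_max_right m n)) (hu _)
      rw [Vs, h] at h1 ⊢
      exact (R m).trans h1 ((R m).symm (hR.mono (le_max_left m n) (hx _)))
    refine ⟨⟨x, (V_sub f 0 (hmem 0)).1, fun hxF => ?_⟩, fun n => V_anti f n.le_succ (hmem n)⟩
    obtain ⟨n, hn⟩ := mem_iUnion.1 hxF
    exact (V_sub f n (hmem n)).2 hn
  choose φ hφ using code
  choose ψ hψ using point
  refine ⟨{ toFun := φ, invFun := ψ, left_inv := ?_, right_inv := ?_, continuous_toFun := ?_,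
            continuous_invFun := ?_ }⟩
  · intro x
    exact Subtype.ext (hR.sep _ _ fun n => V_small (φ x) n _ _ (hψ _ (n + 1)) (hφ x (n + 1)))
  · intro f
    funext n
    exact V_inj _ _ (n + 1) _ (hφ (ψ f) (n + 1)) (hψ f (n + 1)) n n.lt_succ_self
  · refine continuous_pi fun n => continuous_discrete_rng.2 fun i => ?_
    rw [isOpen_iff_mem_nhds]
    intro x hx
    have : (Subtype.val ⁻¹' V (n + 1) (φ x) : Set ↥(B \ ⋃ n, F n)) ∈ 𝓝 x :=
      ((V_ok _ (n + 1)).1.preimage continuous_subtype_val).mem_nhds (hφ x (n + 1))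
    filter_upwards [this] with y hy
    have h := V_inj _ _ (n + 1) _ (hφ y (n + 1)) hy n n.lt_succ_self
    simp only [mem_preimage, mem_singleton_iff] at hx ⊢
    rw [h, hx]
  · rw [continuous_induced_rng, continuous_iff_continuousAt]
    intro f
    refine (hR.basis _).tendsto_right_iff.2 fun n _ => ?_
    have : {g : ℕ → I | ∀ k ∈ Iio (n + 1), g k = f k} ∈ 𝓝 f := by
      have : IsOpen (Set.pi (Iio (n + 1)) fun k => ({f k} : Set I)) :=
        isOpen_set_pi (finite_Iio _) fun _ _ => isOpen_discrete _
      exact this.mem_nhds fun k _ => rfl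
    filter_upwards [this] with g hg
    have h := hψ g (n + 1)
    rw [V_congr g f (n + 1) fun k hk => hg k hk] at h
    exact V_small f n _ _ (hψ f (n + 1)) h

theorem exists_homeomorph_compl (hR : IsBranchingBasis R I) {U : Set X} (hU : IsOpen U)
    {F : ℕ → Set X} (hF : ∀ n, IsClosed (F n)) (hF' : ∀ n, interior (F n) = ∅)
    (hFU : ∀ n, F n ⊆ U) :
    ∃ g : ↥((⋃ j, F j)ᶜ) ≃ₜ X, ∀ x : ↥((⋃ j, F j)ᶜ), (x : X) ∉ U → g x = (x : X) := by
  classical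
  obtain ⟨k, -, hkU, hkeq⟩ := hR.exists_level hU 0
  -- The maps are chosen as functions of the set `B`, so that all points of a class use the same
  -- homeomorphism.
  have local_homeo : ∀ B : Set X, ∃ φ ψ : X → X, IsOpen B ∧ B.Nonempty →
      (∀ x ∈ B, x ∉ ⋃ n, F n → φ x ∈ B ∧ ψ (φ x) = x) ∧
      (∀ x ∈ B, ψ x ∈ B ∧ ψ x ∉ ⋃ n, F n ∧ φ (ψ x) = x) ∧
      ContinuousOn φ (B \ ⋃ n, F n) ∧ ContinuousOn ψ B := by
    intro B
    by_cases hB : IsOpen B ∧ B.Nonempty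
    swap
    · exact ⟨id, id, fun h => absurd h hB⟩
    let _ : TopologicalSpace I := ⊥
    have : DiscreteTopology I := ⟨rfl⟩
    obtain ⟨e₁⟩ := hR.exists_homeomorph_pi hB.1 hB.2 hF hF'
    obtain ⟨e₂⟩ := hR.exists_homeomorph_pi (F := fun _ => ∅) hB.1 hB.2
      (fun _ => isClosed_empty) fun _ => interior_empty
    have hB' : B \ ⋃ _ : ℕ, (∅ : Set X) = B := by simp
    let e : ↥(B \ ⋃ n, F n) ≃ₜ ↥B := (e₁.trans e₂.symm).trans (Homeomorph.setCongr hB')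
    refine ⟨fun x => if h : x ∈ B \ ⋃ n, F n then e ⟨x, h⟩ else x,
      fun x => if h : x ∈ B then e.symm ⟨x, h⟩ else x, fun _ => ⟨?_, ?_, ?_, ?_⟩⟩
    · intro x hx hxF
      have h : x ∈ B \ ⋃ n, F n := ⟨hx, hxF⟩
      simp [h]
    · intro x hx
      have h := (e.symm ⟨x, hx⟩).2
      refine ⟨?_, ?_, ?_⟩
      · simpa only [hx, dif_pos] using h.1
      · simpa only [hx, dif_pos] using h.2
      · simp only [hx, dif_pos, h, Subtype.coe_eta, Homeomorph.apply_symm_apply]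
    · rw [continuousOn_iff_continuous_domRestrict]
      convert continuous_subtype_val.comp e.continuous using 1
      funext x
      simp [x.2.1, -mem_iUnion, x.2.2]
    · rw [continuousOn_iff_continuous_domRestrict]
      convert continuous_subtype_val.comp e.symm.continuous using 1
      funext x
      simp
  choose φ ψ h using local_homeo
  choose hφ hψ hφc hψc using h
  let b : X → Set X := fun x => {y | R (k x) x y}
  have b_ok : ∀ x, IsOpen (b x) ∧ (b x).Nonempty := fun x =>
    ⟨hR.isOpen_class _ _, x, (R _).refl x⟩
  have b_self : ∀ x, x ∈ b x := fun x => (R _).refl x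
  have b_eq : ∀ x ∈ U, ∀ y ∈ b x, b y = b x := by
    intro x hx y hy
    have h : k y = k x := hkeq x hx y hy
    ext z
    change R (k y) y z ↔ R (k x) x z
    rw [h]
    exact ⟨fun hz => (R _).trans hy hz, fun hz => (R _).trans ((R _).symm hy) hz⟩
  -- If `k y ≤ n`, the class of `y` inside `U` would contain `x`. So the class of `y` is finer than
  -- level `n`, and moving within it stays `n`-close to `x`.
  have near : ∀ x ∉ U, ∀ n, ∀ y ∈ U, R n x y → ∀ z ∈ b y, R n x z := by
    intro x hx n y hy hxy z hz
    have hlt : n < k y := by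
      by_contra hle
      exact hx (hkU y hy ((R _).symm (hR.mono (not_lt.1 hle) hxy)))
    exact (R n).trans hxy (hR.mono hlt.le hz)
  let G : X → X := fun x => if x ∈ U then φ (b x) x else x
  let H : X → X := fun x => if x ∈ U then ψ (b x) x else x
  have hG : ∀ x ∈ U, G x = φ (b x) x := fun x hx => if_pos hx
  have hG' : ∀ x ∉ U, G x = x := fun x hx => if_neg hx
  have hH : ∀ x ∈ U, H x = ψ (b x) x := fun x hx => if_pos hx
  have hH' : ∀ x ∉ U, H x = x := fun x hx => if_neg hx
  have HF : ∀ x, H x ∈ (⋃ n, F n)ᶜ := by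
    intro x
    by_cases hx : x ∈ U
    · rw [hH x hx]
      exact (hψ _ (b_ok x) x (b_self x)).2.1
    · rw [hH' x hx]
      exact fun h => hx (iUnion_subset hFU h)
  refine ⟨{ toFun := fun x => G x, invFun := fun x => ⟨H x, HF x⟩, left_inv := ?_,
            right_inv := ?_, continuous_toFun := ?_, continuous_invFun := ?_ },
    fun x hx => hG' x hx⟩
  · rintro ⟨x, hxF⟩
    apply Subtype.ext
    change H (G x) = x
    by_cases hx : x ∈ U
    · obtain ⟨h1, h2⟩ := hφ _ (b_ok x) x (b_self x) hxF
      rw [hG x hx, hH _ (hkU x hx h1), b_eq x hx _ h1, h2]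
    · rw [hG' x hx, hH' x hx]
  · intro x
    change G (H x) = x
    by_cases hx : x ∈ U
    · obtain ⟨h1, -, h2⟩ := hψ _ (b_ok x) x (b_self x)
      rw [hH x hx, hG _ (hkU x hx h1), b_eq x hx _ h1, h2]
    · rw [hH' x hx, hG' x hx]
  · refine (continuousOn_iff_continuous_domRestrict (f := G)).1 ?_
    intro x hxF
    by_cases hx : x ∈ U
    · have h1 : ContinuousWithinAt (φ (b x)) (b x \ ⋃ n, F n) x :=
        hφc _ (b_ok x) x ⟨b_self x, hxF⟩
      have h2 : b x \ ⋃ n, F n ∈ 𝓝[(⋃ n, F n)ᶜ] x :=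
        inter_mem (mem_nhdsWithin_of_mem_nhds ((b_ok x).1.mem_nhds (b_self x)))
          self_mem_nhdsWithin
      refine (h1.mono_of_mem_nhdsWithin h2).congr_of_eventuallyEq ?_ (hG x hx)
      filter_upwards [h2] with y hy
      rw [hG y (hkU x hx hy.1), b_eq x hx y hy.1]
    · rw [ContinuousWithinAt, hG' x hx]
      refine (hR.basis _).tendsto_right_iff.2 fun n _ => ?_
      have h2 : {y | R n x y} ∈ 𝓝[(⋃ n, F n)ᶜ] x :=
        mem_nhdsWithin_of_mem_nhds ((hR.basis x).mem_of_mem trivial)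
      filter_upwards [h2, self_mem_nhdsWithin] with y hy hyF
      by_cases hyU : y ∈ U
      · rw [hG y hyU]
        exact near x hx n y hyU hy _ (hφ _ (b_ok y) y (b_self y) hyF).1
      · rw [hG' y hyU]
        exact hy
  · refine Continuous.subtype_mk (continuous_iff_continuousAt.2 fun x => ?_) _
    by_cases hx : x ∈ U
    · have h2 : b x ∈ 𝓝 x := (b_ok x).1.mem_nhds (b_self x)
      refine ((hψc _ (b_ok x)).continuousAt h2).congr_of_eventuallyEq ?_
      filter_upwards [h2] with y hy
      rw [hH y (hkU x hx hy), b_eq x hx y hy]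
    · rw [ContinuousAt, hH' x hx]
      refine (hR.basis _).tendsto_right_iff.2 fun n _ => ?_
      have h2 : {y | R n x y} ∈ 𝓝 x := (hR.basis x).mem_of_mem trivial
      filter_upwards [h2] with y hy
      by_cases hyU : y ∈ U
      · rw [hH y hyU]
        exact near x hx n y hyU hy _ (hψ _ (b_ok y) y (b_self y)).1
      · rw [hH' y hyU]
        exact hy

end IsBranchingBasis

/-! ### Digit expansions and cardinality -/

section Digits

variable {K : Type*} [NontriviallyNormedField K]

theorem norm_sub_le_of_ultrametric [IsUltrametricDist K] {x y z : K} {r : ℝ} (h : ‖x - y‖ ≤ r) (h' : ‖y - z‖ ≤ r) :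
    ‖x - z‖ ≤ r := by
  rw [← dist_eq_norm] at *
  exact (dist_triangle_max x y z).trans (max_le h h')

/-- Representatives of the residues of the unit ball modulo `a`. -/
structure IsDigitSystem {Q : Type*} (a : K) (rep : Q → K) : Prop where
  norm_le : ∀ q, ‖rep q‖ ≤ 1
  sep : ∀ q q', ‖rep q - rep q'‖ ≤ ‖a‖ → q = q'
  exists_near : ∀ x, ‖x‖ ≤ 1 → ∃ q, ‖x - rep q‖ ≤ ‖a‖

theorem exists_isDigitSystem.{u} {K : Type u} [NontriviallyNormedField K] [IsUltrametricDist K]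
    (a : K) : ∃ (Q : Type u) (_ : Nonempty Q) (rep : Q → K), IsDigitSystem a rep := by
  let S : Setoid {x : K // ‖x‖ ≤ 1} :=
    { r := fun x y => ‖(x : K) - y‖ ≤ ‖a‖
      iseqv :=
        { refl := fun x => by simp
          symm := fun {x y} h => by rwa [norm_sub_rev]
          trans := fun h h' => norm_sub_le_of_ultrametric h h' } }
  refine ⟨Quotient S, ⟨Quotient.mk S ⟨0, by simp⟩⟩, fun q => (q.out : K),
    fun q => q.out.2, fun q q' h => ?_, fun x hx => ⟨Quotient.mk S ⟨x, hx⟩, ?_⟩⟩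
  · rw [← q.out_eq, ← q'.out_eq]
    exact Quotient.sound h
  · have h : S ⟨x, hx⟩ (Quotient.mk S ⟨x, hx⟩).out :=
      Setoid.symm' S (Quotient.exact (s := S) (Quotient.out_eq _))
    exact h

variable {Q : Type*} {a : K} {rep : Q → K}

/-- Scaling by `a ^ m` brings `x` into the unit ball, where finite expansions in powers of `a`
approximate it. -/
theorem IsDigitSystem.exists_approx (h : IsDigitSystem a rep) (ha : 0 < ‖a‖) (ha' : ‖a‖ < 1) :
    ∃ D : ℕ × List Q → K, ∀ (x : K) (n : ℕ), ∃ t, ‖x - D t‖ ≤ ‖a‖ ^ n := by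
  have ha0 : a ≠ 0 := norm_pos_iff.1 ha
  let E : List Q → K := fun l => l.foldr (fun q s => rep q + a * s) 0
  have hE : ∀ (n : ℕ) (x : K), ‖x‖ ≤ 1 → ∃ l, ‖x - E l‖ ≤ ‖a‖ ^ n := by
    intro n
    induction n with
    | zero => exact fun x hx => ⟨[], by simpa [E] using hx⟩
    | succ n ih =>
      intro x hx
      obtain ⟨q, hq⟩ := h.exists_near x hx
      obtain ⟨l, hl⟩ := ih ((x - rep q) / a) (by
        rw [norm_div]
        exact div_le_one_of_le₀ hq ha.le)
      refine ⟨q :: l, ?_⟩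
      have : x - E (q :: l) = a * ((x - rep q) / a - E l) := by
        simp only [E, List.foldr_cons]
        field_simp
        ring
      rw [this, norm_mul, pow_succ']
      gcongr
  refine ⟨fun t => E t.2 / a ^ t.1, fun x n => ?_⟩
  obtain ⟨m, hm⟩ : ∃ m : ℕ, ‖a‖ ^ m * ‖x‖ ≤ 1 := by
    have := ((tendsto_pow_atTop_nhds_zero_of_lt_one ha.le ha').mul_const ‖x‖).eventually_le_const
      (u := 1) (by simp)
    exact this.exists
  obtain ⟨l, hl⟩ := hE (m + n) (a ^ m * x) (by rwa [norm_mul, norm_pow])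
  refine ⟨(m, l), ?_⟩
  have : x - E l / a ^ m = (a ^ m * x - E l) / a ^ m := by field_simp
  rw [this, norm_div, norm_pow, div_le_iff₀ (pow_pos ha m), ← pow_add, add_comm n m]
  exact hl

theorem nonempty_list_embedding_nat_prod (Q : Type*) [Nonempty Q] :
    Nonempty (List (ℕ × List Q) ↪ ℕ × Q) := by
  obtain ⟨e⟩ : Nonempty (List (ℕ × Q) ≃ ℕ × Q) :=
    Cardinal.eq.1 (Cardinal.mk_list_eq_mk (ℕ × Q))
  -- The appended last letter records `m` even when the list is empty.
  let j : ℕ × List Q ↪ ℕ × Q :=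
    ⟨fun t => e (t.2.map (fun q => (t.1 + 1, q)) ++ [(t.1, Classical.arbitrary Q)]), by
      rintro ⟨m, l⟩ ⟨m', l'⟩ h
      have h1 := e.injective h
      simp only at h1
      obtain ⟨h2, h3⟩ := List.append_inj' h1 rfl
      simp only [List.cons.injEq, Prod.mk.injEq, and_true] at h3
      subst h3
      rw [Prod.mk.injEq]
      exact ⟨rfl, List.map_injective_iff.2 (fun _ _ h => (Prod.mk.inj h).2) h2⟩⟩
  exact ⟨⟨fun L => e (L.map j), e.injective.comp (List.map_injective_iff.2 j.injective)⟩⟩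

theorem nonempty_nat_prod_embedding (Q : Type*) : Nonempty (ℕ × (ℕ × Q) ↪ ℕ × Q) :=
  ⟨((Equiv.prodAssoc ℕ ℕ Q).symm.trans
    (Equiv.prodCongr (Denumerable.eqv (ℕ × ℕ)) (Equiv.refl Q))).toEmbedding⟩

end Digits

/-! ### Branching bases from coordinates -/

section Coordinates

variable {X K : Type*} [NontriviallyNormedField K] [IsUltrametricDist K]

/-- Points whose coordinates in `S n` agree up to `‖a‖ ^ n`. -/
def coordSetoid (coord : X → ℕ → K) (S : ℕ → Set ℕ) (a : K) (n : ℕ) : Setoid X where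
  r x y := ∀ i ∈ S n, ‖coord x i - coord y i‖ ≤ ‖a‖ ^ n
  iseqv :=
    { refl := fun x i _ => by simp
      symm := fun h i hi => by
        rw [norm_sub_rev]
        exact h i hi
      trans := fun h h' i hi => norm_sub_le_of_ultrametric (h i hi) (h' i hi) }

variable {coord : X → ℕ → K} {S : ℕ → Set ℕ} {a : K} {Q : Type*} {rep : Q → K}

theorem coordSetoid_iff {n : ℕ} {x y : X} :
    coordSetoid coord S a n x y ↔ ∀ i ∈ S n, ‖coord x i - coord y i‖ ≤ ‖a‖ ^ n := Iff.rfl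

theorem coordSetoid_succ_le (hS : Monotone S) (ha' : ‖a‖ < 1) (n : ℕ) :
    coordSetoid coord S a (n + 1) ≤ coordSetoid coord S a n := fun _ _ h i hi =>
  (h i (hS n.le_succ hi)).trans (pow_le_pow_of_le_one (norm_nonneg a) ha'.le n.le_succ)

theorem isBranchingBasis_coordSetoid [TopologicalSpace X] [Nonempty Q]
    (hcoord : Function.Injective coord)
    (hS : Monotone S) (hS' : ⋃ n, S n = univ) (ha : 0 < ‖a‖) (ha' : ‖a‖ < 1)
    (hrep : IsDigitSystem a rep)
    (hbasis : ∀ x, (𝓝 x).HasBasis (fun _ : ℕ => True) fun n => {y | coordSetoid coord S a n x y})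
    (hlim : ∀ u : ℕ → X, (∀ n, coordSetoid coord S a n (u n) (u (n + 1))) →
      ∃ x, Tendsto u atTop (𝓝 x))
    (hfin : ∀ z : ℕ → K, (∃ N, ∀ i ≥ N, z i = 0) → ∃ x, coord x = z)
    (htail : ∀ x n, ∃ N, ∀ i ∈ S n, N ≤ i → ‖coord x i‖ ≤ ‖a‖ ^ n)
    (hbranch : ∀ x n, ∃ m, ∃ f : ℕ × Q → X, (∀ i, coordSetoid coord S a n x (f i)) ∧
      ∀ i j, coordSetoid coord S a m (f i) (f j) → i = j) :
    IsBranchingBasis (coordSetoid coord S a) (ℕ × Q) where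
  anti := coordSetoid_succ_le hS ha'
  basis := hbasis
  sep := by
    intro x y h
    apply hcoord
    funext i
    obtain ⟨n, hn⟩ := mem_iUnion.1 (hS' ▸ mem_univ i : i ∈ ⋃ n, S n)
    rw [← sub_eq_zero, ← norm_le_zero_iff]
    refine ge_of_tendsto (tendsto_pow_atTop_nhds_zero_of_lt_one ha.le ha') ?_
    filter_upwards [eventually_ge_atTop n] with m hm
    exact h m i (hS hm hn)
  complete := by
    intro u hu
    obtain ⟨x, hx⟩ := hlim u hu
    have hanti : Antitone (coordSetoid coord S a) :=
      antitone_nat_of_succ_le (coordSetoid_succ_le hS ha')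
    have hle : ∀ n m, n ≤ m → coordSetoid coord S a n (u n) (u m) := by
      intro n m hnm
      induction m, hnm using Nat.le_induction with
      | base => exact Setoid.refl' _ _
      | succ m hm ih => exact Setoid.trans' _ ih (hanti hm (hu m))
    refine ⟨x, fun n => ?_⟩
    obtain ⟨m, h1, h2⟩ :=
      (((hbasis x).tendsto_right_iff.1 hx n trivial).and (eventually_ge_atTop n)).exists
    exact Setoid.trans' _ h1 (Setoid.symm' _ (hle n m h2))
  embed := by
    -- Sequences of finite support whose entries are finite expansions meet every class, and finite
    -- lists over `ℕ × List Q` code them.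
    intro n
    obtain ⟨D, hD⟩ := hrep.exists_approx ha ha'
    have hg : ∀ L : List (ℕ × List Q), ∃ x, coord x = fun i => (L[i]?).elim 0 D := fun L =>
      hfin _ ⟨L.length, fun i hi => by simp [List.getElem?_eq_none hi]⟩
    choose g hg using hg
    have hsurj : Function.Surjective fun L => Quotient.mk (coordSetoid coord S a n) (g L) := by
      intro q
      induction q using Quotient.inductionOn with | _ x => ?_
      obtain ⟨N, hN⟩ := htail x n
      choose t ht using fun i => hD (coord x i) n
      refine ⟨(List.range N).map t, Quotient.sound ?_⟩
      refine Setoid.symm' _ fun i hi => ?_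
      rw [hg]
      by_cases h : i < N
      · simpa [h] using ht i
      · simpa [h] using hN i hi (not_lt.1 h)
    obtain ⟨ι⟩ := nonempty_list_embedding_nat_prod Q
    exact ⟨(Function.Embedding.ofSurjective _ hsurj).trans ι⟩
  branch := hbranch
  index := nonempty_nat_prod_embedding Q

theorem IsBranchingBasis.exists_homeomorph_compl_of_deficient [TopologicalSpace X] {I : Type*}
    (hR : IsBranchingBasis (coordSetoid coord S a) I)
    (hmove : ∀ x n j, ∃ y, coordSetoid coord S a n x y ∧ coord y j ≠ coord x j)
    {U : Set X} {F : ℕ → Set X} (hU : IsOpen U) (hF : ∀ j, IsClosed (F j)) (hFU : ∀ j, F j ⊆ U)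
    (hdef : ∀ j, InfinitelyDeficient coord (F j)) :
    ∃ g : ↥((⋃ j, F j)ᶜ) ≃ₜ X, ∀ x : ↥((⋃ j, F j)ᶜ), (x : X) ∉ U → g x = (x : X) := by
  refine hR.exists_homeomorph_compl hU hF (fun n => ?_) hFU
  obtain ⟨β, hβ, hdir⟩ := hdef n
  obtain ⟨j, hj⟩ := hβ.nonempty
  obtain ⟨c, hc⟩ := hdir j hj
  have hc' : ∀ x ∈ F n, coord x j = c := fun x hx => by
    have : coord x j ∈ (fun x : X => coord x j) '' F n := mem_image_of_mem _ hx
    rwa [hc] at this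
  rw [eq_empty_iff_forall_notMem]
  intro x hx
  obtain ⟨m, hm⟩ := hR.exists_class_subset isOpen_interior hx
  obtain ⟨y, hy, hne⟩ := hmove x m j
  exact hne ((hc' y (interior_subset (hm hy))).trans (hc' x (interior_subset hx)).symm)

end Coordinates

/-! ### The two sequence spaces -/

section Spaces

variable {K : Type*} [NontriviallyNormedField K] {a : K} {Q : Type*} {rep : Q → K}

theorem exists_zeroAtInfty_eq (z : ℕ → K) (hz : ∃ N, ∀ i ≥ N, z i = 0) :
    ∃ x : C₀(ℕ, K), (fun i => x i) = z := by
  refine ⟨⟨⟨z, continuous_of_discreteTopology⟩, ?_⟩, rfl⟩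
  obtain ⟨N, hN⟩ := hz
  rw [cocompact_eq_cofinite, Nat.cofinite_eq_atTop]
  refine tendsto_const_nhds.congr' ?_
  filter_upwards [eventually_ge_atTop N] with i hi
  exact (hN i hi).symm

variable [IsUltrametricDist K]

theorem coordSetoid_zeroAtInfty_iff {n : ℕ} {x y : C₀(ℕ, K)} :
    coordSetoid (fun (x : C₀(ℕ, K)) i => x i) (fun _ => univ) a n x y ↔ dist x y ≤ ‖a‖ ^ n := by
  rw [← ZeroAtInftyContinuousMap.dist_toBCF_eq_dist,
    BoundedContinuousFunction.dist_le (by positivity), coordSetoid_iff]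
  simp [dist_eq_norm]

theorem isBranchingBasis_zeroAtInfty [CompleteSpace K] [Nonempty Q] (ha : 0 < ‖a‖)
    (ha' : ‖a‖ < 1) (hrep : IsDigitSystem a rep) :
    IsBranchingBasis (coordSetoid (fun (x : C₀(ℕ, K)) i => x i) (fun _ => univ) a) (ℕ × Q) := by
  refine isBranchingBasis_coordSetoid DFunLike.coe_injective monotone_const (iUnion_const univ)
    ha ha' hrep (fun x => ?_) (fun u hu => ?_) exists_zeroAtInfty_eq (fun x n => ?_)
    (fun x n => ?_)
  · convert Metric.nhds_basis_closedBall_pow (x := x) ha ha' using 2 with n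
    ext y
    rw [mem_ofPred_eq, coordSetoid_zeroAtInfty_iff, Metric.mem_closedBall, dist_comm]
  · refine cauchySeq_tendsto_of_complete (cauchySeq_of_le_geometric ‖a‖ 1 ha' fun n => ?_)
    rw [one_mul]
    exact coordSetoid_zeroAtInfty_iff.1 (hu n)
  · have h : Tendsto (fun i => ‖x i‖) atTop (𝓝 0) := by
      have := (zero_at_infty x).norm
      rwa [cocompact_eq_cofinite, Nat.cofinite_eq_atTop, norm_zero] at this
    obtain ⟨N, hN⟩ := eventually_atTop.1 (h.eventually_le_const (pow_pos ha n))
    exact ⟨N, fun i _ hi => hN i hi⟩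
  -- The entry `a ^ n` at place `2k` marks `k`, and the next place carries the digit; both survive
  -- at level `n + 1`.
  · have hz : ∀ t : ℕ × Q, ∃ w : C₀(ℕ, K), (fun i => w i) = fun i =>
        if i = 2 * t.1 then a ^ n else if i = 2 * t.1 + 1 then a ^ n * rep t.2 else 0 := fun t =>
      exists_zeroAtInfty_eq _ ⟨2 * t.1 + 2, fun i hi => by
        rw [if_neg (by omega), if_neg (by omega)]⟩
    choose w hw using hz
    have hw' := fun t => congrFun (hw t)
    refine ⟨n + 1, fun t => x + w t, fun t i _ => ?_, fun t t' h => ?_⟩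
    · simp only [ZeroAtInftyContinuousMap.add_apply, sub_add_cancel_left, norm_neg]
      rw [hw' t i]
      split_ifs
      · rw [norm_pow]
      · rw [norm_mul, norm_pow]
        exact mul_le_of_le_one_right (by positivity) (hrep.norm_le _)
      · rw [norm_zero]
        positivity
    · have h' : ∀ i, ‖w t i - w t' i‖ ≤ ‖a‖ ^ (n + 1) := fun i => by
        simpa using h i (mem_univ i)
      have h1 : t.1 = t'.1 := by
        by_contra hne
        have := h' (2 * t.1)
        rw [hw' t, hw' t', if_pos rfl, if_neg (by omega), if_neg (by omega), sub_zero,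
          norm_pow] at this
        exact absurd this (not_le.2 (pow_lt_pow_right_of_lt_one₀ ha ha' n.lt_succ_self))
      refine Prod.ext h1 (hrep.sep _ _ ?_)
      have := h' (2 * t.1 + 1)
      rw [hw' t, hw' t', if_neg (by omega), if_pos rfl, if_neg (by omega), if_pos (by omega),
        ← mul_sub, norm_mul, norm_pow, pow_succ] at this
      exact le_of_mul_le_mul_left this (pow_pos ha n)

theorem hasBasis_nhds_pi_coordSetoid (ha : 0 < ‖a‖) (ha' : ‖a‖ < 1) (x : ℕ → K) :
    (𝓝 x).HasBasis (fun _ : ℕ => True)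
      fun n => {y | coordSetoid (fun (x : ℕ → K) i => x i) (fun n => Iio n) a n x y} := by
  have hball : ∀ (c y : K) (n : ℕ), y ∈ Metric.closedBall c (‖a‖ ^ n) ↔ ‖c - y‖ ≤ ‖a‖ ^ n := by
    intro c y n
    rw [Metric.mem_closedBall, dist_comm, dist_eq_norm]
  refine ⟨fun s => ⟨fun hs => ?_, ?_⟩⟩
  · rw [nhds_pi, Filter.mem_pi] at hs
    obtain ⟨J, hJ, t, ht, hts⟩ := hs
    choose m _ hm using fun i =>
      (Metric.nhds_basis_closedBall_pow (x := x i) ha ha').mem_iff.1 (ht i)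
    obtain ⟨N, hN⟩ := (hJ.image fun i => max (i + 1) (m i)).bddAbove
    refine ⟨N, trivial, fun y hy => hts fun i hi => hm i ?_⟩
    have h := hN (mem_image_of_mem _ hi)
    rw [hball]
    exact (hy i (Nat.lt_of_succ_le ((le_max_left _ _).trans h))).trans
      (pow_le_pow_of_le_one ha.le ha'.le ((le_max_right _ _).trans h))
  · rintro ⟨n, -, hn⟩
    refine mem_of_superset (set_pi_mem_nhds (finite_Iio n) fun i _ =>
      Metric.closedBall_mem_nhds (x i) (pow_pos ha n)) fun y hy => hn fun i hi => ?_
    exact (hball _ _ _).1 (hy i hi)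

theorem isBranchingBasis_pi [CompleteSpace K] [Nonempty Q] (ha : 0 < ‖a‖)
    (ha' : ‖a‖ < 1) (hrep : IsDigitSystem a rep) :
    IsBranchingBasis (coordSetoid (fun (x : ℕ → K) i => x i) (fun n => Iio n) a) (ℕ × Q) := by
  refine isBranchingBasis_coordSetoid (fun x y h => h) (fun m n h => Iio_subset_Iio h)
    (iUnion_eq_univ_iff.2 fun i => ⟨i + 1, Nat.lt_succ_self i⟩)
    ha ha' hrep (hasBasis_nhds_pi_coordSetoid ha ha') (fun u hu => ?_) (fun z _ => ⟨z, rfl⟩)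
    (fun x n => ⟨n, fun i hi h => absurd hi (not_lt.2 h)⟩) (fun x n => ?_)
  · have : ∀ i, ∃ c, Tendsto (fun n => u n i) atTop (𝓝 c) := by
      intro i
      obtain ⟨c, hc⟩ := cauchySeq_tendsto_of_complete
        -- Coordinate `i` is controlled only from level `i + 1` on.
        (cauchySeq_of_le_geometric (f := fun n => u (n + (i + 1)) i) ‖a‖ 1 ha' fun n => by
          rw [one_mul, dist_eq_norm, add_right_comm]
          exact (hu (n + (i + 1)) i (by rw [mem_Iio]; omega)).trans
            (pow_le_pow_of_le_one ha.le ha'.le (by omega)))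
      exact ⟨c, (tendsto_add_atTop_iff_nat (f := fun n => u n i) (i + 1)).1 hc⟩
    choose c hc using this
    exact ⟨c, tendsto_pi_nhds.2 hc⟩
  -- Level `n` leaves coordinates `n` and `n + 1` free: the first encodes `k` by the norm of `a⁻¹ ^
  -- k`, the second holds the digit.
  · refine ⟨n + 2, fun t i => if i < n then x i else if i = n then a⁻¹ ^ t.1 else rep t.2,
      fun t i hi => ?_, fun t t' h => ?_⟩
    · rw [mem_Iio] at hi
      simp [hi]
    · have h1 := h n (by rw [mem_Iio]; omega)
      have h2 := h (n + 1) (by rw [mem_Iio]; omega)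
      simp only [lt_irrefl, if_false, if_true] at h1
      simp only [Nat.not_succ_lt_self, Nat.succ_ne_self, if_false] at h2
      refine Prod.ext ?_ (hrep.sep _ _ (h2.trans ?_))
      · have hinv : 1 < ‖a⁻¹‖ := by
          rw [norm_inv]
          exact (one_lt_inv₀ ha).2 ha'
        have key : ∀ k l : ℕ, ‖a⁻¹ ^ k - a⁻¹ ^ l‖ ≤ ‖a‖ ^ (n + 2) → k ≤ l := by
          intro k l hkl
          have hl : ‖a⁻¹ ^ l - 0‖ ≤ ‖a⁻¹‖ ^ l := by rw [sub_zero, norm_pow]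
          have hone : ‖a‖ ^ (n + 2) ≤ ‖a⁻¹‖ ^ l :=
            (pow_le_one₀ ha.le ha'.le).trans (one_le_pow₀ hinv.le)
          have hk := norm_sub_le_of_ultrametric (hkl.trans hone) hl
          rw [sub_zero, norm_pow] at hk
          exact (pow_le_pow_iff_right₀ hinv).1 hk
        exact le_antisymm (key _ _ h1) (key _ _ (by rwa [norm_sub_rev]))
      · calc ‖a‖ ^ (n + 2) ≤ ‖a‖ ^ 1 := pow_le_pow_of_le_one ha.le ha'.le (by omega)
          _ = ‖a‖ := pow_one _

end Spaces

/-- `C₀(ℕ, K)` is the space of null sequences with the supremum norm, and `ℕ → K` carries the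
product topology. -/
theorem theorem31 (K : Type*) [NontriviallyNormedField K] [IsUltrametricDist K]
    [CompleteSpace K] :
    (∀ (U : Set C₀(ℕ, K)) (F : ℕ → Set C₀(ℕ, K)), IsOpen U →
      (∀ j, IsClosed (F j)) → (∀ j, F j ⊆ U) →
      (∀ j, InfinitelyDeficient (fun (x : C₀(ℕ, K)) (i : ℕ) => x i) (F j)) →
      ∃ g : ↥((⋃ j, F j)ᶜ) ≃ₜ C₀(ℕ, K),
        ∀ x : ↥((⋃ j, F j)ᶜ), (x : C₀(ℕ, K)) ∉ U → g x = (x : C₀(ℕ, K))) ∧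
    (∀ (U : Set (ℕ → K)) (F : ℕ → Set (ℕ → K)), IsOpen U →
      (∀ j, IsClosed (F j)) → (∀ j, F j ⊆ U) →
      (∀ j, InfinitelyDeficient (fun (x : ℕ → K) (i : ℕ) => x i) (F j)) →
      ∃ g : ↥((⋃ j, F j)ᶜ) ≃ₜ (ℕ → K),
        ∀ x : ↥((⋃ j, F j)ᶜ), (x : ℕ → K) ∉ U → g x = (x : ℕ → K)) := by
  obtain ⟨a, ha, ha'⟩ := NormedField.exists_norm_lt_one K
  obtain ⟨Q, _, rep, hrep⟩ := exists_isDigitSystem a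
  have ha0 : a ≠ 0 := norm_pos_iff.1 ha
  constructor
  · intro U F hU hF hFU hdef
    refine (isBranchingBasis_zeroAtInfty ha ha' hrep).exists_homeomorph_compl_of_deficient
      (fun x n j => ?_) hU hF hFU hdef
    obtain ⟨w, hw⟩ := exists_zeroAtInfty_eq (fun i => if i = j then a ^ n else 0)
      ⟨j + 1, fun i hi => if_neg (by omega)⟩
    have hw' := congrFun hw
    refine ⟨x + w, fun i _ => ?_, ?_⟩
    · simp only [ZeroAtInftyContinuousMap.add_apply, sub_add_cancel_left, norm_neg]
      rw [hw' i]
      split_ifs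
      · rw [norm_pow]
      · rw [norm_zero]
        positivity
    · simp only [ZeroAtInftyContinuousMap.add_apply, ne_eq, add_eq_left]
      rw [hw' j, if_pos rfl]
      exact pow_ne_zero n ha0
  · intro U F hU hF hFU hdef
    refine (isBranchingBasis_pi ha ha' hrep).exists_homeomorph_compl_of_deficient
      (fun x n j => ⟨Function.update x j (x j + a ^ n), fun i _ => ?_, ?_⟩) hU hF hFU hdef
    · rcases eq_or_ne i j with rfl | h
      · simp
      · simp [h]
    · simp [ha0]
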